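/- Let $\Omega\subset\mathbb C^n$ be a bounded strictly pseudoconvex domain with smooth boundary: there are an open neighbourhood $\Omega'$ of $\overline\Omega$ and a smooth function $\rho:\Omega'\to\mathbb R$ with $dd^c\rho>0$ on $\Omega'$, $\Omega=\{z\in\Omega' : \rho(z)<0\}$ and $d\rho\neq0$ on $\partial\Omega$. Let $A=\{\zeta\in\mathbb C : 1<|\zeta|<e\}$, and let $\varphi_0,\varphi_1\in C^{1,1}(\overline\Omega)$ be real-valued functions that are plurisubharmonic in $\Omega$ and vanish on $\partial\Omega$. Define $\Psi$ on $\partial(\Omega\times A)$ by $$\Psi(z,\zeta)=\varphi_0(z)\ \text{ if } |\zeta|=1,\qquad \Psi(z,\zeta)=\varphi_1(z)\ \text{ if } |\zeta|=e,\qquad \Psi(z,\zeta)=0\ \text{ if } z\in\partial\Omega,$$ let $$\mathcal F(\Psi,\Omega\times A)=\{u\in PSH(\Omega\times A)\cap C^0(\overline\Omega\times\overline A) : u\le\Psi \text{ on } \partial(\Omega\times A)\},$$ and let $\Phi(z,\zeta)=\sup\{u(z,\zeta) : u\in\mathcal F(\Psi,\Omega\times A)\}$ be the Perron–Bremermann envelope.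 **Theorem 2.6.** The envelope $\Phi$ is finite on $\overline\Omega\times A$, and it is Lipschitz in the space variable $z$, up to the boundary of $\Omega$, uniformly in $\zeta\in A$: there is a constant $C\ge0$, depending only on $\Omega,\varphi_0,\varphi_1$, such that $$|\Phi(z,\zeta)-\Phi(w,\zeta)|\le C\,\|z-w\|\qquad\text{for all } z,w\in\overline\Omega \text{ and } \zeta\in A.$$ -/

import Mathlib

open Set Filter Topology
open scoped NNReal ContDiff

namespace MabuchiEnvelope

/-- Complex Euclidean space `ℂⁿ`, with its Hermitian norm. -/
abbrev Cn (n : ℕ) : Type := EuclideanSpace ℂ (Fin n)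

/-- A real-valued function `u` is plurisubharmonic on the open set `D` of a complex normed space:
it is upper semicontinuous on `D`, and along every complex line `t ↦ a + t b` through a point `a`
of `D` it satisfies the submean value inequality on all sufficiently small circles around `a`.
(A finite-valued plurisubharmonic function is always integrable on such circles; integrability is
recorded so that the mean value is the genuine one.) -/
def IsPSH {V : Type*} [NormedAddCommGroup V] [NormedSpace ℂ V] (D : Set V) (u : V → ℝ) : Prop :=
  UpperSemicontinuousOn u D ∧
    ∀ a ∈ D, ∀ b : V, ∀ᶠ r : ℝ in 𝓝[>] 0,
      CircleIntegrable (fun t : ℂ => u (a + t • b)) 0 r ∧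
        u a ≤ Real.circleAverage (fun t : ℂ => u (a + t • b)) 0 r

/-- The Levi form `D²ρ(z)(v, v) + D²ρ(z)(iv, iv) = 4 ∑ (∂²ρ / ∂z_j ∂z̄_k)(z) v_j v̄_k`.
For a smooth `ρ`, `ddᶜ ρ > 0` at `z` means that it is positive for every `v ≠ 0`. -/
noncomputable def leviForm {n : ℕ} (ρ : Cn n → ℝ) (z v : Cn n) : ℝ :=
  fderiv ℝ (fderiv ℝ ρ) z v v +
    fderiv ℝ (fderiv ℝ ρ) z (Complex.I • v) (Complex.I • v)

/-- `Ω` is a bounded strictly pseudoconvex domain of `ℂⁿ` with smooth boundary: there is a smooth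
strictly plurisubharmonic function `ρ` on an open neighbourhood `U` of `closure Ω` with
`Ω = {ρ < 0}` and `dρ ≠ 0` on the boundary. -/
structure IsStrictlyPseudoconvexDomain {n : ℕ} (Ω : Set (Cn n)) : Prop where
  isOpen : IsOpen Ω
  isConnected : IsConnected Ω
  isBounded : Bornology.IsBounded Ω
  exists_defining : ∃ (U : Set (Cn n)) (ρ : Cn n → ℝ),
    IsOpen U ∧ closure Ω ⊆ U ∧ ContDiffOn ℝ ∞ ρ U ∧
      Ω = {z ∈ U | ρ z < 0} ∧
      (∀ z ∈ U, ∀ v : Cn n, v ≠ 0 → 0 < leviForm ρ z v) ∧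
      ∀ z ∈ frontier Ω, fderiv ℝ ρ z ≠ 0

/-- `φ` is of class `C^{1,1}` up to the boundary of `Ω`: it is continuous on `closure Ω` and
differentiable in `Ω`, with a Lipschitz differential. -/
def IsC11 {n : ℕ} (Ω : Set (Cn n)) (φ : Cn n → ℝ) : Prop :=
  ContinuousOn φ (closure Ω) ∧ DifferentiableOn ℝ φ Ω ∧
    ∃ K : ℝ≥0, LipschitzOnWith K (fderiv ℝ φ) Ω

/-- An admissible end point: a plurisubharmonic function in `Ω`, of class `C^{1,1}` up to the
boundary, with boundary values `0`. -/
structure IsEndPoint {n : ℕ} (Ω : Set (Cn n)) (φ : Cn n → ℝ) : Prop where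
  isC11 : IsC11 Ω φ
  isPSH : IsPSH Ω φ
  boundary : ∀ z ∈ frontier Ω, φ z = 0

/-- The annulus `A = {1 < |ζ| < e}`. -/
def annulus : Set ℂ := {ζ | 1 < ‖ζ‖ ∧ ‖ζ‖ < Real.exp 1}

open Classical in
/-- The boundary data `Ψ`: `φ₀` on `|ζ| = 1`, `φ₁` on `|ζ| = e`, and `0` on the rest of the
boundary of `Ω × A`, that is, on `∂Ω × A`. -/
noncomputable def boundaryData {n : ℕ} (φ₀ φ₁ : Cn n → ℝ) (p : Cn n × ℂ) : ℝ :=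
  if ‖p.2‖ = 1 then φ₀ p.1 else if ‖p.2‖ = Real.exp 1 then φ₁ p.1 else 0

/-- The family `𝓕(Ψ, Ω × A)` of functions that are plurisubharmonic in `Ω × A`, continuous on
`closure Ω × closure A`, and at most `Ψ` on `∂(Ω × A)`. -/
def subsolutions {n : ℕ} (Ω : Set (Cn n)) (Ψ : Cn n × ℂ → ℝ) : Set (Cn n × ℂ → ℝ) :=
  {u | IsPSH (Ω ×ˢ annulus) u ∧ ContinuousOn u (closure Ω ×ˢ closure annulus) ∧
    ∀ p ∈ frontier (Ω ×ˢ annulus), u p ≤ Ψ p}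

/-- The values at `p` of the functions of the family. -/
def subsolutionValues {n : ℕ} (Ω : Set (Cn n)) (Ψ : Cn n × ℂ → ℝ) (p : Cn n × ℂ) : Set ℝ :=
  (fun u : Cn n × ℂ → ℝ => u p) '' subsolutions Ω Ψ

/-- The Perron-Bremermann envelope `Φ(p) = sup {u(p) | u ∈ 𝓕(Ψ, Ω × A)}`. -/
noncomputable def envelope {n : ℕ} (Ω : Set (Cn n)) (Ψ : Cn n × ℂ → ℝ) (p : Cn n × ℂ) : ℝ :=
  sSup (subsolutionValues Ω Ψ p)

end MabuchiEnvelope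

/-!
A large multiple `w` of a strictly plurisubharmonic defining function `ρ` is a barrier: since
`dρ ≠ 0` on `∂Ω`, every Lipschitz function vanishing on `∂Ω` is `O(|ρ|)` on `Ω̄`, so
`w ≤ φᵢ ≤ -w`. Hence `w` itself competes in the envelope, and the maximum principle gives
`u ≤ -w` for every competitor `u`. If all the data are `K`-Lipschitz, then for a competitor `u` and
a translation `h` the function `max (u(z + h, ζ) - K ‖h‖, w(z))`, continued by `w(z)` where
`z + h ∉ Ω`, is again a competitor, because `u ≤ -w = 0` on `∂Ω`. This yields
`Φ(z + h, ζ) - K ‖h‖ ≤ Φ(z, ζ)`.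
-/

namespace MabuchiEnvelope

section LipschitzUpToTheBoundary

variable {E : Type*} [NormedAddCommGroup E] [NormedSpace ℝ E]
  {Ω : Set E} {f : E → ℝ} {M : ℝ≥0}

lemma lipschitzOnWith_closure_of_nnnorm_fderiv_le (hc : ContinuousOn f (closure Ω))
    (hd : ∀ x ∈ Ω, DifferentiableAt ℝ f x) (hM : ∀ x ∈ Ω, ‖fderiv ℝ f x‖₊ ≤ M) {s : Set E}
    (hs : Convex ℝ s) (hsΩ : s ⊆ Ω) : LipschitzOnWith M f (closure s) :=
  (hs.lipschitzOnWith_of_nnnorm_fderiv_le (fun x hx => hd x (hsΩ hx))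
    fun x hx => hM x (hsΩ hx)).closure (hc.mono (closure_mono hsΩ))

variable [FiniteDimensional ℝ E]

lemma exists_mem_frontier_dist_le (hΩ : IsOpen Ω) {x y : E} (hx : x ∈ closure Ω) (hy : y ∉ Ω) :
    ∃ q ∈ frontier Ω, dist x q ≤ dist x y ∧ Metric.ball x (dist x q) ⊆ Ω := by
  by_cases hxΩ : x ∈ Ω
  · obtain ⟨q, hq, hxq⟩ := exists_mem_frontier_infDist_compl_eq_dist hxΩ
      (ne_univ_iff_exists_notMem Ω |>.2 ⟨y, hy⟩)
    exact ⟨q, hq, hxq ▸ Metric.infDist_le_dist_of_mem hy,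
      hxq ▸ Metric.ball_infDist_compl_subset⟩
  · exact ⟨x, hΩ.frontier_eq ▸ ⟨hx, hxΩ⟩, by simp, by simp⟩

lemma abs_le_mul_dist_of_notMem (hΩ : IsOpen Ω) (hf : LipschitzOnWith M f (closure Ω))
    (h0 : ∀ x ∈ frontier Ω, f x = 0) {x y : E} (hx : x ∈ closure Ω) (hy : y ∉ Ω) :
    |f x| ≤ M * dist x y := by
  obtain ⟨q, hq, hxq, -⟩ := exists_mem_frontier_dist_le hΩ hx hy
  calc |f x| = dist (f x) (f q) := by rw [h0 q hq, Real.dist_0_eq_abs]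
    _ ≤ M * dist x q := hf.dist_le_mul x hx q (frontier_subset_closure hq)
    _ ≤ M * dist x y := by gcongr

lemma lipschitzOnWith_of_nnnorm_fderiv_le_of_eq_zero_on_frontier (hΩ : IsOpen Ω)
    (hc : ContinuousOn f (closure Ω)) (hd : DifferentiableOn ℝ f Ω)
    (hM : ∀ x ∈ Ω, ‖fderiv ℝ f x‖₊ ≤ M) (h0 : ∀ x ∈ frontier Ω, f x = 0) :
    LipschitzOnWith M f (closure Ω) := by
  have hconvex : ∀ {s : Set E}, Convex ℝ s → s ⊆ Ω → LipschitzOnWith M f (closure s) :=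
    lipschitzOnWith_closure_of_nnnorm_fderiv_le hc
      (fun x hx => (hd x hx).differentiableAt (hΩ.mem_nhds hx)) hM
  have hexit : ∀ x ∈ closure Ω, ∀ y ∉ Ω, |f x| ≤ M * dist x y := by
    intro x hx y hy
    obtain ⟨q, hq, hxq, hball⟩ := exists_mem_frontier_dist_le hΩ hx hy
    rcases eq_or_ne x q with rfl | hne
    · rw [h0 x hq, abs_zero]
      positivity
    have hpos := dist_pos.2 hne
    have hcl := closure_ball x hpos.ne'
    calc |f x| = dist (f x) (f q) := by rw [h0 q hq, Real.dist_0_eq_abs]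
      _ ≤ M * dist x q := (hconvex (convex_ball x _) hball).dist_le_mul
          x (hcl ▸ Metric.mem_closedBall_self hpos.le) q (hcl ▸ Metric.mem_closedBall'.2 le_rfl)
      _ ≤ M * dist x y := by gcongr
  refine LipschitzOnWith.of_dist_le_mul fun x hx y hy => ?_
  by_cases hseg : openSegment ℝ x y ⊆ Ω
  · have hcl := closure_openSegment (𝕜 := ℝ) x y
    exact (hconvex (convex_openSegment x y) hseg).dist_le_mul
      x (hcl ▸ left_mem_segment ℝ x y) y (hcl ▸ right_mem_segment ℝ x y)
  · obtain ⟨q, hq, hqΩ⟩ := not_subset.1 hseg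
    calc dist (f x) (f y) ≤ |f x| + |f y| := abs_sub _ _
      _ ≤ M * dist x q + M * dist y q := add_le_add (hexit x hx q hqΩ) (hexit y hy q hqΩ)
      _ = M * dist x y := by
        rw [← mul_add, dist_comm y q,
          dist_add_dist_of_mem_segment (openSegment_subset_segment ℝ x y hq)]

lemma exists_lipschitzOnWith_of_isBounded_image_fderiv (hΩ : IsOpen Ω)
    (hc : ContinuousOn f (closure Ω)) (hd : DifferentiableOn ℝ f Ω)
    (hb : Bornology.IsBounded (fderiv ℝ f '' Ω)) (h0 : ∀ x ∈ frontier Ω, f x = 0) :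
    ∃ K, LipschitzOnWith K f (closure Ω) := by
  obtain ⟨M, -, hM⟩ := hb.exists_pos_norm_le
  exact ⟨M.toNNReal, lipschitzOnWith_of_nnnorm_fderiv_le_of_eq_zero_on_frontier hΩ hc hd
    (fun x hx => NNReal.le_toNNReal_of_coe_le (hM _ (mem_image_of_mem _ hx))) h0⟩

lemma exists_lipschitzOnWith_of_contDiffAt (hΩ : IsOpen Ω) (hb : Bornology.IsBounded Ω)
    (hf : ∀ x ∈ closure Ω, ContDiffAt ℝ 1 f x) (h0 : ∀ x ∈ frontier Ω, f x = 0) :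
    ∃ K, LipschitzOnWith K f (closure Ω) := by
  have hfderiv : ContinuousOn (fderiv ℝ f) (closure Ω) := fun x hx =>
    ((hf x hx).continuousAt_fderiv one_ne_zero).continuousWithinAt
  exact exists_lipschitzOnWith_of_isBounded_image_fderiv hΩ
    (fun x hx => (hf x hx).continuousAt.continuousWithinAt)
    (fun x hx => ((hf x (subset_closure hx)).differentiableAt
      one_ne_zero).differentiableWithinAt)
    ((hb.isCompact_closure.image_of_continuousOn hfderiv).isBounded.subset
      (image_mono subset_closure)) h0

end LipschitzUpToTheBoundary

lemma IsEndPoint.exists_lipschitzOnWith {n : ℕ} {Ω : Set (Cn n)} {φ : Cn n → ℝ}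
    (hφ : IsEndPoint Ω φ) (hΩ : IsOpen Ω) (hb : Bornology.IsBounded Ω) :
    ∃ K, LipschitzOnWith K φ (closure Ω) := by
  obtain ⟨hc, hd, L, hL⟩ := hφ.isC11
  have hbdd : Bornology.IsBounded (fderiv ℝ φ '' Ω) :=
    Metric.isBounded_image_iff.2 ⟨L * Metric.diam Ω, fun x hx y hy =>
      (hL.dist_le_mul x hx y hy).trans (by gcongr; exact Metric.dist_le_diam_of_mem hb hx hy)⟩
  exact exists_lipschitzOnWith_of_isBounded_image_fderiv hΩ hc hd hbdd hφ.boundary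

section DefiningFunctions

open Asymptotics

lemma isBigO_principal_of_forall_isBigO_nhdsWithin {X E F : Type*} [TopologicalSpace X] [Norm E]
    [SeminormedAddCommGroup F] {K : Set X} (hK : IsCompact K) {f : X → E} {g : X → F}
    (h : ∀ x ∈ K, f =O[𝓝[K] x] g) : f =O[𝓟 K] g := by
  refine hK.induction_on (p := fun s => f =O[𝓟 s] g) (by simp)
    (fun s t hst ht => ht.mono (principal_mono.2 hst))
    (fun s t hs ht => sup_principal (s := s) (t := t) ▸ hs.sup ht) fun x hx => ?_
  obtain ⟨c, hc⟩ := (h x hx).bound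
  exact ⟨_, hc, isBigO_principal.2 ⟨c, fun _ => id⟩⟩

lemma exists_eventually_exists_eq_dist_le {E F : Type*} [NormedAddCommGroup E] [NormedSpace ℝ E]
    [CompleteSpace E] [NormedAddCommGroup F] [NormedSpace ℝ F] [CompleteSpace F] {f : E → F}
    {f' : E →L[ℝ] F} {a : E} (hf : HasStrictFDerivAt f f' a) (hf' : f'.range = ⊤) :
    ∃ C : ℝ≥0, ∀ᶠ x in 𝓝 a, ∃ y, f y = f a ∧ dist x y ≤ C * dist (f x) (f a) := by
  let g := f'.nonlinearRightInverseOfSurjective hf'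
  have hg : 0 < g.nnnorm := f'.nonlinearRightInverseOfSurjective_nnnorm_pos hf'
  obtain ⟨s, hs, happrox⟩ := hf.approximates_deriv_on_nhds (c := g.nnnorm⁻¹ / 2)
    (Or.inr (by positivity))
  obtain ⟨δ, hδ, hball⟩ := Metric.mem_nhds_iff.1 hs
  have hsmall : ∀ᶠ x in 𝓝 a, 2 * g.nnnorm * dist (f x) (f a) + dist x a < δ := by
    have hcont : ContinuousAt (fun x => 2 * g.nnnorm * dist (f x) (f a) + dist x a) a := by
      have := hf.continuousAt
      fun_prop
    exact hcont.eventually_lt_const (by simpa using hδ)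
  refine ⟨2 * g.nnnorm, hsmall.mono fun x hx => ?_⟩
  have hsurj := happrox.surjOn_closedBall_of_nonlinearRightInverse g
    (ε := 2 * g.nnnorm * dist (f x) (f a)) (by positivity)
    ((Metric.closedBall_subset_ball' hx).trans hball)
  have hradius : ((g.nnnorm : ℝ)⁻¹ - (g.nnnorm⁻¹ / 2 : ℝ≥0)) * (2 * g.nnnorm * dist (f x) (f a))
      = dist (f x) (f a) := by
    have : (g.nnnorm : ℝ) ≠ 0 := by positivity
    push_cast
    field_simp
    ring
  rw [hradius] at hsurj
  obtain ⟨y, hy, hfy⟩ := hsurj (Metric.mem_closedBall'.2 le_rfl)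
  exact ⟨y, hfy, Metric.mem_closedBall'.1 hy⟩

lemma isBigO_principal_closure_of_fderiv_ne_zero {E : Type*} [NormedAddCommGroup E]
    [NormedSpace ℝ E] [FiniteDimensional ℝ E] {Ω : Set E} {f ρ : E → ℝ} {M : ℝ≥0}
    (hΩ : IsOpen Ω) (hb : Bornology.IsBounded Ω) (hf : LipschitzOnWith M f (closure Ω))
    (hf0 : ∀ x ∈ frontier Ω, f x = 0) (hρ : ∀ x ∈ closure Ω, ContDiffAt ℝ 1 ρ x)
    (hρΩ : ∀ x ∈ Ω, ρ x ≠ 0) (hρ0 : ∀ x ∈ frontier Ω, ρ x = 0)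
    (hρ' : ∀ x ∈ frontier Ω, fderiv ℝ ρ x ≠ 0) : f =O[𝓟 (closure Ω)] ρ := by
  have hcompact : IsCompact (closure Ω) := hb.isCompact_closure
  refine isBigO_principal_of_forall_isBigO_nhdsWithin hcompact fun x hx => ?_
  by_cases hxΩ : x ∈ Ω
  · have hρc : ContinuousWithinAt ρ (closure Ω) x := (hρ x hx).continuousAt.continuousWithinAt
    rw [isBigO_iff_isBoundedUnder_le_div (hρc.eventually_ne (hρΩ x hxΩ))]
    exact ((hf.continuousOn x hx).norm.div hρc.norm
      (norm_ne_zero_iff.2 (hρΩ x hxΩ))).isBoundedUnder_le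
  · have hxfr : x ∈ frontier Ω := hΩ.frontier_eq ▸ ⟨hx, hxΩ⟩
    obtain ⟨C, hC⟩ := exists_eventually_exists_eq_dist_le
      ((hρ x hx).hasStrictFDerivAt one_ne_zero)
      (Module.Dual.range_eq_top_of_ne_zero (by exact_mod_cast hρ' x hxfr))
    refine IsBigO.of_bound (M * C) ?_
    filter_upwards [nhdsWithin_le_nhds hC, self_mem_nhdsWithin] with p ⟨y, hy, hpy⟩ hp
    have hyΩ : y ∉ Ω := fun h => hρΩ y h (hy.trans (hρ0 x hxfr))
    rw [hρ0 x hxfr, Real.dist_0_eq_abs] at hpy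
    calc ‖f p‖ ≤ M * dist p y := abs_le_mul_dist_of_notMem hΩ hf hf0 hp hyΩ
      _ ≤ M * (C * |ρ p|) := by gcongr
      _ = M * C * ‖ρ p‖ := by rw [mul_assoc, Real.norm_eq_abs]

lemma eq_zero_of_mem_frontier_of_eq_sep_neg {X : Type*} [TopologicalSpace X] {Ω U : Set X}
    {ρ : X → ℝ} (hΩ : IsOpen Ω) (hΩU : closure Ω ⊆ U) (hρ : ContinuousOn ρ (closure Ω))
    (hdef : Ω = {x ∈ U | ρ x < 0}) {x : X} (hx : x ∈ frontier Ω) : ρ x = 0 := by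
  have hxc := frontier_subset_closure hx
  have hneg : MapsTo ρ Ω (Iic 0) := fun y hy => (hdef.subset hy).2.le
  have hle : ρ x ≤ 0 := isClosed_Iic.closure_subset
    (((hρ x hxc).mono subset_closure).mem_closure hxc hneg)
  refine hle.antisymm (not_lt.1 fun h => ?_)
  exact (hΩ.frontier_eq ▸ hx).2 (hdef.superset ⟨hΩU hxc, h⟩)

end DefiningFunctions

section Plurisubharmonic

variable {V W : Type*} [NormedAddCommGroup V] [NormedSpace ℂ V] [NormedAddCommGroup W]
  [NormedSpace ℂ W] {D G : Set V} {u v w : V → ℝ} {a : V}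

/-- The submean value inequality of `u` at `a` on all small circles in complex lines through `a`,
with the integrability that makes the averages genuine; `IsPSH D u` is upper semicontinuity of `u`
on `D` together with `SubmeanAt u a` at every `a ∈ D`. -/
def SubmeanAt (u : V → ℝ) (a : V) : Prop :=
  ∀ b : V, ∀ᶠ r : ℝ in 𝓝[>] 0,
    CircleIntegrable (fun t : ℂ => u (a + t • b)) 0 r ∧
      u a ≤ Real.circleAverage (fun t : ℂ => u (a + t • b)) 0 r

lemma eventually_forall_closedBall_add_smul {p : V → Prop} (hp : ∀ᶠ x in 𝓝 a, p x) (b : V) :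
    ∀ᶠ r : ℝ in 𝓝[>] 0, ∀ t ∈ Metric.closedBall (0 : ℂ) r, p (a + t • b) := by
  have hline : Tendsto (fun t : ℂ => a + t • b) (𝓝 0) (𝓝 a) :=
    Continuous.tendsto' (by fun_prop) _ _ (by simp)
  exact nhdsWithin_le_nhds (eventually_closedBall_subset (hline.eventually hp))

lemma circleIntegrable_add_smul {b : V} {r : ℝ} (hr : 0 ≤ r)
    (h : ∀ t ∈ Metric.closedBall (0 : ℂ) r, ContinuousAt u (a + t • b)) :
    CircleIntegrable (fun t : ℂ => u (a + t • b)) 0 r :=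
  ContinuousOn.circleIntegrable hr fun t ht =>
    (ContinuousAt.comp (f := fun t : ℂ => a + t • b)
      (h t (Metric.sphere_subset_closedBall ht)) (by fun_prop)).continuousWithinAt

lemma submeanAt_const (c : ℝ) (a : V) : SubmeanAt (fun _ => c) a := fun _ =>
  Eventually.of_forall fun _ =>
    ⟨circleIntegrable_const _ _ _, (Real.circleAverage_const _ _ _).ge⟩

lemma SubmeanAt.add (hu : SubmeanAt u a) (hv : SubmeanAt v a) :
    SubmeanAt (fun x => u x + v x) a := fun b => by
  filter_upwards [hu b, hv b] with r hur hvr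
  refine ⟨hur.1.add hvr.1, ?_⟩
  rw [Real.circleAverage_fun_add hur.1 hvr.1]
  exact add_le_add hur.2 hvr.2

lemma SubmeanAt.const_mul (hu : SubmeanAt u a) {c : ℝ} (hc : 0 ≤ c) :
    SubmeanAt (fun x => c * u x) a := fun b => by
  filter_upwards [hu b] with r hur
  refine ⟨hur.1.const_smul, ?_⟩
  have := Real.circleAverage_fun_smul (a := c) (f := fun t : ℂ => u (a + t • b)) (c := 0) (R := r)
  simp only [smul_eq_mul] at this
  rw [this]
  exact mul_le_mul_of_nonneg_left hur.2 hc

lemma SubmeanAt.comp_affine (L : W →L[ℂ] V) (c : V) {x : W} (hu : SubmeanAt u (L x + c)) :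
    SubmeanAt (fun y => u (L y + c)) x := fun b => by
  simpa only [map_add, map_smul, add_right_comm _ c] using hu (L b)

lemma SubmeanAt.of_eventually_le (hv : SubmeanAt v a) (hvu : ∀ᶠ x in 𝓝 a, v x ≤ u x)
    (hva : v a = u a) (hu : ∀ᶠ x in 𝓝 a, ContinuousAt u x) : SubmeanAt u a := fun b => by
  filter_upwards [hv b, eventually_forall_closedBall_add_smul hvu b,
    eventually_forall_closedBall_add_smul hu b, self_mem_nhdsWithin] with r hvr hle hcont hr
  have hr : 0 < r := hr
  have hint := circleIntegrable_add_smul hr.le hcont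
  refine ⟨hint, hva ▸ hvr.2.trans (Real.circleAverage_mono hvr.1 hint fun t ht => ?_)⟩
  rw [abs_of_pos hr] at ht
  exact hle t (Metric.sphere_subset_closedBall ht)

lemma isPSH_const (D : Set V) (c : ℝ) : IsPSH D fun _ => c :=
  ⟨upperSemicontinuousOn_const, fun a _ => submeanAt_const c a⟩

lemma IsPSH.add (hu : IsPSH D u) (hv : IsPSH D v) : IsPSH D fun x => u x + v x :=
  ⟨hu.1.add hv.1, fun a ha => SubmeanAt.add (hu.2 a ha) (hv.2 a ha)⟩

lemma IsPSH.const_mul {c : ℝ} (hu : IsPSH D u) (hc : 0 ≤ c) : IsPSH D fun x => c * u x :=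
  ⟨(continuous_const_mul c).comp_upperSemicontinuousOn hu.1 (monotone_mul_left_of_nonneg hc),
    fun a ha => SubmeanAt.const_mul (hu.2 a ha) hc⟩

lemma IsPSH.comp_affine (hu : IsPSH D u) (L : W →L[ℂ] V) (c : V) {D' : Set W}
    (h : MapsTo (fun x => L x + c) D' D) : IsPSH D' fun x => u (L x + c) :=
  ⟨hu.1.comp (by fun_prop) h, fun _ hx => SubmeanAt.comp_affine L c (hu.2 _ (h hx))⟩

lemma isPSH_piecewise_sup [∀ x, Decidable (x ∈ G)] (hD : IsOpen D) (hG : IsOpen G)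
    (hu : IsPSH (D ∩ G) u) (hw : IsPSH D w) (hc : ContinuousOn (G.piecewise (u ⊔ w) w) D) :
    IsPSH D (G.piecewise (u ⊔ w) w) := by
  refine ⟨hc.upperSemicontinuousOn, fun a ha => ?_⟩
  have hcont : ∀ᶠ x in 𝓝 a, ContinuousAt (G.piecewise (u ⊔ w) w) x :=
    (hD.eventually_mem ha).mono fun x hx => hc.continuousAt (hD.mem_nhds hx)
  have hw_le : ∀ x, w x ≤ G.piecewise (u ⊔ w) w x := fun x =>
    G.le_piecewise (fun _ _ => le_sup_right) (fun _ _ => le_rfl) x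
  by_cases h : a ∈ G ∧ w a < u a
  · refine SubmeanAt.of_eventually_le (hu.2 a ⟨ha, h.1⟩) ?_ (by simp [h.1, h.2.le]) hcont
    filter_upwards [hG.eventually_mem h.1] with x hx
    simp [hx]
  · refine SubmeanAt.of_eventually_le (hw.2 a ha) (Eventually.of_forall hw_le) ?_ hcont
    by_cases haG : a ∈ G
    · simpa [haG] using h
    · simp [haG]

lemma circleAverage_lt {f : ℂ → ℝ} {c : ℂ} {r M : ℝ} (hf : ContinuousOn f (Metric.sphere c |r|))
    (hle : ∀ z ∈ Metric.sphere c |r|, f z ≤ M) (hlt : ∃ z ∈ Metric.sphere c |r|, f z < M) :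
    Real.circleAverage f c r < M := by
  obtain ⟨z, hz, hzM⟩ := hlt
  obtain ⟨θ, hθ, rfl⟩ := (image_circleMap_Ioc c r).superset hz
  have hint : ∫ θ in (0 : ℝ)..2 * Real.pi, f (circleMap c r θ) <
      ∫ _ in (0 : ℝ)..2 * Real.pi, M :=
    intervalIntegral.integral_lt_integral_of_continuousOn_of_le_of_exists_lt Real.two_pi_pos
      (hf.comp (continuous_circleMap c r).continuousOn fun θ _ => circleMap_mem_sphere' c r θ)
      continuousOn_const (fun θ _ => hle _ (circleMap_mem_sphere' c r θ))
      ⟨θ, Ioc_subset_Icc_self hθ, hzM⟩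
  rw [intervalIntegral.integral_const, smul_eq_mul, sub_zero] at hint
  rwa [Real.circleAverage_def, smul_eq_mul, inv_mul_lt_iff₀ Real.two_pi_pos]

lemma IsPSH.le_of_frontier_le [Nontrivial V] (hD : IsOpen D) (hcpt : IsCompact (closure D))
    (hu : IsPSH D u) (hc : ContinuousOn u (closure D)) {M : ℝ} (hM : ∀ x ∈ frontier D, u x ≤ M) :
    ∀ x ∈ closure D, u x ≤ M := by
  intro x hx
  obtain ⟨y, hy, hymax⟩ := hcpt.exists_isMaxOn ⟨x, hx⟩ hc
  obtain ⟨b, hb⟩ := exists_ne (0 : V)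
  obtain ⟨ℓ, -, hℓb⟩ := exists_dual_vector ℂ b (norm_ne_zero_iff.2 hb)
  have hℓ : Continuous fun x => (ℓ x).re := by fun_prop
  have hmaxset : IsCompact (closure D ∩ u ⁻¹' {u y}) :=
    hcpt.of_isClosed_subset (hc.preimage_isClosed_of_isClosed isClosed_closure isClosed_singleton)
      inter_subset_left
  -- Circles in the direction `b` around a point of `D` where `u` is maximal consist of such points,
  -- so `Re ℓ` is not maximal at it among them.
  obtain ⟨a, ⟨ha, hay : u a = u y⟩, hamax⟩ := hmaxset.exists_isMaxOn ⟨y, hy, rfl⟩ hℓ.continuousOn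
  have hmax : ∀ z ∈ closure D, u z ≤ u a := fun z hz => (hymax hz).trans_eq hay.symm
  refine (hmax x hx).trans ?_
  refine hM a (hD.frontier_eq ▸ ⟨ha, fun haD => ?_⟩)
  obtain ⟨r, ⟨-, hmean⟩, hrD, hr : 0 < r⟩ := ((hu.2 a haD b).and
    ((eventually_forall_closedBall_add_smul (hD.eventually_mem haD) b).and
      self_mem_nhdsWithin)).exists
  have hcircle : ∀ t ∈ Metric.sphere (0 : ℂ) |r|, a + t • b ∈ closure D := fun t ht =>
    subset_closure (hrD t (Metric.sphere_subset_closedBall (abs_of_pos hr ▸ ht)))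
  refine hmean.not_gt (circleAverage_lt (hc.comp (by fun_prop) hcircle)
    (fun t ht => hmax _ (hcircle t ht)) ⟨r, by simp, ?_⟩)
  have hrmem := hcircle r (by simp)
  refine (hmax _ hrmem).lt_of_ne fun heq => ?_
  have hle : (ℓ (a + (r : ℂ) • b)).re ≤ (ℓ a).re := hamax ⟨hrmem, heq.trans hay⟩
  have : 0 < r * ‖b‖ := by positivity
  have hstep : (ℓ (a + (r : ℂ) • b)).re = (ℓ a).re + r * ‖b‖ := by simp [hℓb]
  linarith

end Plurisubharmonic

section LeviForm

open Asymptotics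

lemma isLittleO_taylor_two {E F : Type*} [NormedAddCommGroup E] [NormedSpace ℝ E]
    [NormedAddCommGroup F] [NormedSpace ℝ F] {f : E → F} {a : E} (hf : ContDiffAt ℝ 2 f a) :
    (fun v => f (a + v) - f a - fderiv ℝ f a v - (1 / 2 : ℝ) • fderiv ℝ (fderiv ℝ f) a v v)
      =o[𝓝 0] fun v => ‖v‖ ^ 2 := by
  set Q := fderiv ℝ (fderiv ℝ f) a
  have hsymm : ∀ v w, Q v w = Q w v := (hf.isSymmSndFDerivAt (by simp)).eq
  have hQ : HasFDerivAt (fderiv ℝ f) Q a :=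
    ((hf.fderiv_right (m := 1) (by norm_num)).differentiableAt one_ne_zero).hasFDerivAt
  have hdiff : ∀ᶠ v in 𝓝 (0 : E), DifferentiableAt ℝ f (a + v) :=
    (Continuous.tendsto' (by fun_prop) 0 a (by simp)).eventually
      ((hf.eventually (by simp)).mono fun x hx => hx.differentiableAt two_ne_zero)
  obtain ⟨δ, hδ, hball⟩ := Metric.eventually_nhds_iff_ball.1 hdiff
  have hderiv : ∀ v ∈ Metric.ball (0 : E) δ, HasFDerivWithinAt
      (fun v => f (a + v) - f a - fderiv ℝ f a v - (1 / 2 : ℝ) • Q v v)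
      (fderiv ℝ f (a + v) - fderiv ℝ f a - Q v) (Metric.ball 0 δ) v := fun v hv => by
    have htranslate := ((hball v hv).hasFDerivAt.comp v ((hasFDerivAt_id v).const_add a))
    have hquad := (Q.hasFDerivAt (x := v)).clm_apply (hasFDerivAt_id v)
    refine HasFDerivAt.hasFDerivWithinAt ((((htranslate.sub_const (f a)).sub
      (fderiv ℝ f a).hasFDerivAt).sub (hquad.const_smul (1 / 2 : ℝ))).congr_fderiv ?_)
    ext w
    simp only [ContinuousLinearMap.comp_id, id_eq, smul_add, sub_apply, add_apply, smul_apply,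
      ContinuousLinearMap.flip_apply, hsymm w v]
    module
  have hsmall : (fun v => fderiv ℝ f (a + v) - fderiv ℝ f a - Q v) =o[𝓝 0]
      fun v => ‖v - 0‖ ^ 1 := by
    simpa using (hasFDerivAt_iff_isLittleO_nhds_zero.1 hQ).norm_right
  have := (convex_ball (0 : E) δ).isLittleO_pow_succ (Metric.mem_ball_self hδ) hderiv
    (hsmall.mono nhdsWithin_le_nhds)
  simpa [nhdsWithin_eq_nhds.2 (Metric.ball_mem_nhds (0 : E) hδ)] using this

lemma circleAverage_comp_mul (g : ℂ → ℝ) (r : ℝ) {c : ℂ} (hc : ‖c‖ = 1) :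
    Real.circleAverage (fun t => g (c * t)) 0 r = Real.circleAverage g 0 r := by
  have hrotate : ∀ θ, c * circleMap 0 r θ = circleMap 0 r (θ + c.arg) := fun θ => by
    have hexp : Complex.exp (c.arg * Complex.I) = c := by
      simpa [hc] using Complex.norm_mul_exp_arg_mul_I c
    simp only [circleMap, zero_add, Complex.ofReal_add, add_mul, Complex.exp_add, hexp]
    ring
  simp only [Real.circleAverage_eq_integral_add (f := g) c.arg, Real.circleAverage_def, hrotate]

lemma le_circleAverage_of_le_sum_rotations {ι : Type*} {s : Finset ι} (hs : s.Nonempty) {c : ι → ℂ}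
    (hc : ∀ k ∈ s, ‖c k‖ = 1) {g : ℂ → ℝ} {r m : ℝ} (hg : ContinuousOn g (Metric.sphere 0 |r|))
    (h : ∀ t ∈ Metric.sphere (0 : ℂ) |r|, s.card * m ≤ ∑ k ∈ s, g (c k * t)) :
    m ≤ Real.circleAverage g 0 r := by
  have hint : ∀ k ∈ s, CircleIntegrable (fun t => g (c k * t)) 0 r := fun k hk =>
    (hg.comp (by fun_prop) fun t ht => by simpa [hc k hk] using ht).circleIntegrable'
  have hsum : CircleIntegrable (fun t => ∑ k ∈ s, g (c k * t)) 0 r := by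
    simpa only [Finset.sum_fn] using CircleIntegrable.sum s hint
  have hcard : (0 : ℝ) < s.card := by exact_mod_cast hs.card_pos
  refine le_of_mul_le_mul_left ?_ hcard
  calc s.card * m = Real.circleAverage (fun _ => s.card * m) 0 r :=
        (Real.circleAverage_const _ _ _).symm
    _ ≤ Real.circleAverage (fun t => ∑ k ∈ s, g (c k * t)) 0 r :=
        Real.circleAverage_mono (circleIntegrable_const _ _ _) hsum h
    _ = ∑ _ ∈ s, Real.circleAverage g 0 r := by
        rw [Real.circleAverage_fun_sum hint]
        exact Finset.sum_congr rfl fun k hk => circleAverage_comp_mul g r (hc k hk)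
    _ = s.card * Real.circleAverage g 0 r := by rw [Finset.sum_const, nsmul_eq_mul]

variable {n : ℕ} {ρ : Cn n → ℝ} {a : Cn n}

lemma leviForm_smul (ρ : Cn n → ℝ) (a b : Cn n) (t : ℂ) :
    leviForm ρ a (t • b) = ‖t‖ ^ 2 * leviForm ρ a b := by
  have htb : t • b = t.re • b + t.im • (Complex.I • b) := by
    conv_lhs => rw [← Complex.re_add_im t]
    rw [add_smul, mul_smul, Complex.coe_smul, Complex.coe_smul]
  have hItb : Complex.I • t • b = t.re • (Complex.I • b) - t.im • b := by
    rw [htb, smul_add, smul_comm Complex.I t.re, smul_comm Complex.I t.im, smul_smul Complex.I,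
      Complex.I_mul_I, neg_one_smul, smul_neg, sub_eq_add_neg]
  rw [leviForm, hItb, htb, leviForm, ← Complex.normSq_eq_norm_sq, Complex.normSq_apply]
  simp only [map_add, map_sub, map_smul, add_apply, sub_apply, smul_apply, smul_eq_mul]
  ring

lemma isLittleO_sum_I_pow_sub_leviForm (hρ : ContDiffAt ℝ 2 ρ a) :
    (fun v => ∑ k ∈ Finset.range 4, ρ (a + Complex.I ^ k • v) - 4 * ρ a - leviForm ρ a v)
      =o[𝓝 0] fun v => ‖v‖ ^ 2 := by
  have hrotate : ∀ k ∈ Finset.range 4, (fun v => ρ (a + Complex.I ^ k • v) - ρ a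
      - fderiv ℝ ρ a (Complex.I ^ k • v) - (1 / 2 : ℝ) •
        fderiv ℝ (fderiv ℝ ρ) a (Complex.I ^ k • v) (Complex.I ^ k • v))
      =o[𝓝 0] fun v => ‖v‖ ^ 2 := fun k _ => by
    have htendsto : Tendsto (fun v : Cn n => Complex.I ^ k • v) (𝓝 0) (𝓝 0) :=
      Continuous.tendsto' (by fun_prop) _ _ (by simp)
    simpa [Function.comp_def, norm_smul] using (isLittleO_taylor_two hρ).comp_tendsto htendsto
  -- Summing over the rotations by powers of `i` cancels the differential and the non-Hermitian part
  -- of the Hessian.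
  refine (IsLittleO.sum hrotate).congr_left fun v => ?_
  simp only [Finset.sum_range_succ, Finset.sum_range_zero, Pi.add_apply, Pi.zero_apply, leviForm,
    pow_succ, pow_zero, one_mul, Complex.I_mul_I, neg_mul, neg_smul, one_smul, map_neg, neg_apply,
    smul_eq_mul]
  ring

lemma submeanAt_of_leviForm_pos (hρ : ContDiffAt ℝ 2 ρ a)
    (hpos : ∀ v, v ≠ 0 → 0 < leviForm ρ a v) : SubmeanAt ρ a := fun b => by
  rcases eq_or_ne b 0 with rfl | hb
  · simpa only [smul_zero, add_zero] using submeanAt_const (ρ a) a (0 : Cn n)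
  have hline : Tendsto (fun t : ℂ => t • b) (𝓝 0) (𝓝 0) :=
    Continuous.tendsto' (by fun_prop) _ _ (by simp)
  have hsquare : ∀ᶠ t in 𝓝 (0 : ℂ),
      4 * ρ a ≤ ∑ k ∈ Finset.range 4, ρ (a + Complex.I ^ k • t • b) := by
    have hε : 0 < leviForm ρ a b / ‖b‖ ^ 2 := div_pos (hpos b hb) (by positivity)
    filter_upwards [hline.eventually ((isLittleO_sum_I_pow_sub_leviForm hρ).def hε)] with t ht
    have hremainder : leviForm ρ a b / ‖b‖ ^ 2 * ‖‖t • b‖ ^ 2‖ = leviForm ρ a (t • b) := by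
      rw [leviForm_smul, norm_smul, Real.norm_of_nonneg (by positivity)]
      field_simp
    rw [hremainder, Real.norm_eq_abs] at ht
    linarith [(abs_le.1 ht).1]
  have hcont : ∀ᶠ x in 𝓝 a, ContinuousAt ρ x :=
    (hρ.eventually (by simp)).mono fun x hx => hx.continuousAt
  filter_upwards [eventually_forall_closedBall_add_smul hcont b, self_mem_nhdsWithin,
    nhdsWithin_le_nhds (eventually_closedBall_subset hsquare)] with r hr hr0 hball
  have hr0 : 0 < r := hr0
  refine ⟨circleIntegrable_add_smul hr0.le hr, le_circleAverage_of_le_sum_rotations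
    (s := Finset.range 4) (c := fun k => Complex.I ^ k) (by simp) (by simp)
    (fun t ht => ?_) fun t ht => ?_⟩ <;>
    rw [abs_of_pos hr0] at ht <;>
    replace ht := Metric.sphere_subset_closedBall ht
  · exact (ContinuousAt.comp (f := fun t : ℂ => a + t • b) (hr t ht)
      (by fun_prop)).continuousWithinAt
  · simpa [mul_smul] using hball ht

end LeviForm

lemma isOpen_annulus : IsOpen annulus :=
  (isOpen_lt continuous_const continuous_norm).inter (isOpen_lt continuous_norm continuous_const)

lemma isBounded_annulus : Bornology.IsBounded annulus :=
  (Metric.isBounded_closedBall (x := (0 : ℂ)) (r := Real.exp 1)).subset fun _ hζ =>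
    mem_closedBall_zero_iff.2 hζ.2.le

section Barrier

variable {n : ℕ} {Ω : Set (Cn n)} {φ₀ φ₁ w : Cn n → ℝ} {K : ℝ≥0}

/-- `w` is a barrier for the end points `φ₀` and `φ₁`: a plurisubharmonic function with boundary
values `0` such that `w ≤ φᵢ ≤ -w`. -/
structure IsBarrier (Ω : Set (Cn n)) (φ₀ φ₁ w : Cn n → ℝ) : Prop where
  isPSH : IsPSH Ω w
  eq_zero : ∀ z ∈ frontier Ω, w z = 0
  abs_left_le : ∀ z ∈ closure Ω, |φ₀ z| ≤ -w z
  abs_right_le : ∀ z ∈ closure Ω, |φ₁ z| ≤ -w z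

lemma IsStrictlyPseudoconvexDomain.exists_isPSH_isBigO (hΩ : IsStrictlyPseudoconvexDomain Ω) :
    ∃ (ρ : Cn n → ℝ) (M : ℝ≥0), IsPSH Ω ρ ∧ LipschitzOnWith M ρ (closure Ω) ∧
      (∀ z ∈ closure Ω, ρ z ≤ 0) ∧ (∀ z ∈ frontier Ω, ρ z = 0) ∧
      ∀ {φ : Cn n → ℝ} {L : ℝ≥0}, LipschitzOnWith L φ (closure Ω) →
        (∀ z ∈ frontier Ω, φ z = 0) → φ =O[𝓟 (closure Ω)] ρ := by
  obtain ⟨U, ρ, hU, hΩU, hρ, hdef, hlevi, hdρ⟩ := hΩ.exists_defining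
  have hsmooth : ∀ k : ℕ, ∀ z ∈ closure Ω, ContDiffAt ℝ k ρ z := fun k z hz =>
    (hρ.contDiffAt (hU.mem_nhds (hΩU hz))).of_le (by exact_mod_cast le_top)
  have hcont : ContinuousOn ρ (closure Ω) := hρ.continuousOn.mono hΩU
  have hneg : ∀ z ∈ Ω, ρ z < 0 := fun z hz => (hdef.subset hz).2
  have hzero : ∀ z ∈ frontier Ω, ρ z = 0 := fun z =>
    eq_zero_of_mem_frontier_of_eq_sep_neg hΩ.isOpen hΩU hcont hdef
  obtain ⟨M, hM⟩ := exists_lipschitzOnWith_of_contDiffAt hΩ.isOpen hΩ.isBounded (hsmooth 1) hzero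
  refine ⟨ρ, M, ⟨(hcont.mono subset_closure).upperSemicontinuousOn, fun z hz => ?_⟩, hM,
    fun z hz => ?_, hzero, fun hφ hφ0 => ?_⟩
  · exact submeanAt_of_leviForm_pos (hsmooth 2 z (subset_closure hz))
      (hlevi z (hΩU (subset_closure hz)))
  · exact (closure_eq_self_union_frontier Ω ▸ hz).elim (fun h => (hneg z h).le)
      fun h => (hzero z h).le
  · exact isBigO_principal_closure_of_fderiv_ne_zero hΩ.isOpen hΩ.isBounded hφ hφ0 (hsmooth 1)
      (fun z hz => (hneg z hz).ne) hzero hdρ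

lemma IsStrictlyPseudoconvexDomain.exists_isBarrier (hΩ : IsStrictlyPseudoconvexDomain Ω)
    {K₀ K₁ : ℝ≥0} (hφ₀ : LipschitzOnWith K₀ φ₀ (closure Ω))
    (hφ₁ : LipschitzOnWith K₁ φ₁ (closure Ω)) (h₀ : ∀ z ∈ frontier Ω, φ₀ z = 0)
    (h₁ : ∀ z ∈ frontier Ω, φ₁ z = 0) :
    ∃ L w, LipschitzOnWith L w (closure Ω) ∧ IsBarrier Ω φ₀ φ₁ w := by
  obtain ⟨ρ, M, hρ, hM, hnonpos, hzero, hbigO⟩ := hΩ.exists_isPSH_isBigO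
  obtain ⟨c₀, hc₀⟩ := Asymptotics.isBigO_principal.1 (hbigO hφ₀ h₀)
  obtain ⟨c₁, hc₁⟩ := Asymptotics.isBigO_principal.1 (hbigO hφ₁ h₁)
  let B : ℝ≥0 := (max c₀ c₁).toNNReal
  have habs : ∀ {c : ℝ} {φ : Cn n → ℝ}, c ≤ max c₀ c₁ →
      (∀ z ∈ closure Ω, ‖φ z‖ ≤ c * ‖ρ z‖) → ∀ z ∈ closure Ω, |φ z| ≤ -(B * ρ z) := by
    intro c φ hc hφ z hz
    calc |φ z| ≤ c * ‖ρ z‖ := hφ z hz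
      _ ≤ B * ‖ρ z‖ := by gcongr; exact hc.trans (Real.le_coe_toNNReal _)
      _ = -(B * ρ z) := by rw [Real.norm_of_nonpos (hnonpos z hz), mul_neg]
  exact ⟨B * M, fun z => B * ρ z,
    .of_dist_le_mul fun x hx y hy => by
      calc dist (B * ρ x) (B * ρ y) = B * dist (ρ x) (ρ y) := by
            rw [Real.dist_eq, ← mul_sub, abs_mul, NNReal.abs_eq, ← Real.dist_eq]
        _ ≤ B * (M * dist x y) := by gcongr; exact hM.dist_le_mul x hx y hy
        _ = _ := by rw [NNReal.coe_mul, mul_assoc],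
    hρ.const_mul B.2, fun z hz => by simp [hzero z hz],
    habs (le_max_left _ _) hc₀, habs (le_max_right _ _) hc₁⟩

lemma IsBarrier.abs_boundaryData_le (hw : IsBarrier Ω φ₀ φ₁ w) {p : Cn n × ℂ}
    (hp : p.1 ∈ closure Ω) : |boundaryData φ₀ φ₁ p| ≤ -w p.1 := by
  unfold boundaryData
  split_ifs
  · exact hw.abs_left_le _ hp
  · exact hw.abs_right_le _ hp
  · exact abs_zero.trans_le ((abs_nonneg _).trans (hw.abs_left_le _ hp))

lemma lipschitzOnWith_boundaryData (h₀ : LipschitzOnWith K φ₀ (closure Ω))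
    (h₁ : LipschitzOnWith K φ₁ (closure Ω)) (ζ : ℂ) :
    LipschitzOnWith K (fun z => boundaryData φ₀ φ₁ (z, ζ)) (closure Ω) := by
  simp only [boundaryData]
  split_ifs
  · exact h₀
  · exact h₁
  · exact (LipschitzWith.const 0).lipschitzOnWith.weaken zero_le

lemma IsBarrier.comp_fst_mem_subsolutions (hw : IsBarrier Ω φ₀ φ₁ w)
    (hwc : ContinuousOn w (closure Ω)) :
    (fun p => w p.1) ∈ subsolutions Ω (boundaryData φ₀ φ₁) := by
  refine ⟨?_, hwc.comp continuousOn_fst fun p hp => hp.1, fun p hp => ?_⟩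
  · simpa using hw.isPSH.comp_affine (ContinuousLinearMap.fst ℂ (Cn n) ℂ) 0
      (D' := Ω ×ˢ annulus) fun p hp => by simpa using hp.1
  · have hpc := closure_prod_eq.subset (frontier_subset_closure hp)
    simpa using neg_le_of_abs_le (hw.abs_boundaryData_le hpc.1)

lemma IsBarrier.le_neg_of_mem_subsolutions (hw : IsBarrier Ω φ₀ φ₁ w)
    (hwc : ContinuousOn w (closure Ω)) (hΩ : IsOpen Ω) (hb : Bornology.IsBounded Ω)
    {u : Cn n × ℂ → ℝ} (hu : u ∈ subsolutions Ω (boundaryData φ₀ φ₁)) {p : Cn n × ℂ}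
    (hp : p ∈ closure Ω ×ˢ closure annulus) : u p ≤ -w p.1 := by
  have hsub := hw.comp_fst_mem_subsolutions hwc
  rw [← closure_prod_eq] at hp
  rw [le_neg_iff_add_nonpos_right]
  refine (hu.1.add hsub.1).le_of_frontier_le (hΩ.prod isOpen_annulus)
    (hb.prod isBounded_annulus).isCompact_closure ?_ (fun q hq => ?_) p hp
  · rw [closure_prod_eq]
    exact hu.2.1.add hsub.2.1
  · have hqc := closure_prod_eq.subset (frontier_subset_closure hq)
    rw [← le_neg_iff_add_nonpos_right]
    exact (hu.2.2 q hq).trans (le_of_abs_le (hw.abs_boundaryData_le hqc.1))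

end Barrier

section Translation

variable {n : ℕ} {Ω : Set (Cn n)} {φ₀ φ₁ w : Cn n → ℝ} {K : ℝ≥0} {u : Cn n × ℂ → ℝ} {h : Cn n}

lemma IsBarrier.sub_le_boundaryData (hw : IsBarrier Ω φ₀ φ₁ w)
    (hwL : LipschitzOnWith K w (closure Ω)) (hφ₀ : LipschitzOnWith K φ₀ (closure Ω))
    (hφ₁ : LipschitzOnWith K φ₁ (closure Ω)) (hΩ : IsOpen Ω) (hb : Bornology.IsBounded Ω)
    (hu : u ∈ subsolutions Ω (boundaryData φ₀ φ₁)) {p : Cn n × ℂ}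
    (hp : p ∈ frontier (Ω ×ˢ annulus)) (hph : p.1 + h ∈ closure Ω) :
    u (p + (h, 0)) - K * ‖h‖ ≤ boundaryData φ₀ φ₁ p := by
  obtain ⟨z, ζ⟩ := p
  have hdist : dist (z + h) z = ‖h‖ := by simp
  rw [← hdist, Prod.mk_add_mk, add_zero, sub_le_iff_le_add]
  rcases frontier_prod_eq Ω annulus ▸ hp with ⟨hz, hζ⟩ | ⟨hz, hζ⟩
  · have hfrontier : (z + h, ζ) ∈ frontier (Ω ×ˢ annulus) :=
      frontier_prod_eq Ω annulus ▸ Or.inl ⟨hph, hζ⟩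
    exact (hu.2.2 _ hfrontier).trans
      ((lipschitzOnWith_boundaryData hφ₀ hφ₁ ζ).le_add_mul hph hz)
  · have hzc := frontier_subset_closure hz
    have hdata : 0 ≤ boundaryData φ₀ φ₁ (z, ζ) := by
      have := neg_le_of_abs_le (hw.abs_boundaryData_le (p := (z, ζ)) hzc)
      simpa [hw.eq_zero z hz] using this
    calc u (z + h, ζ) ≤ -w (z + h) :=
        hw.le_neg_of_mem_subsolutions hwL.continuousOn hΩ hb hu ⟨hph, hζ⟩
      _ ≤ K * dist (z + h) z := by
        have := hwL.le_add_mul hzc hph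
        rw [hw.eq_zero z hz, dist_comm] at this
        linarith
      _ ≤ boundaryData φ₀ φ₁ (z, ζ) + K * dist (z + h) z := le_add_of_nonneg_left hdata

lemma IsBarrier.sub_le_of_add_mem_frontier (hw : IsBarrier Ω φ₀ φ₁ w)
    (hwL : LipschitzOnWith K w (closure Ω)) (hΩ : IsOpen Ω) (hb : Bornology.IsBounded Ω)
    (hu : u ∈ subsolutions Ω (boundaryData φ₀ φ₁)) {p : Cn n × ℂ}
    (hp : p ∈ closure Ω ×ˢ closure annulus) (hph : p.1 + h ∈ frontier Ω) :
    u (p + (h, 0)) - K * ‖h‖ ≤ w p.1 := by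
  have hphc := frontier_subset_closure hph
  have hu_le : u (p + (h, 0)) ≤ -w (p.1 + h) :=
    hw.le_neg_of_mem_subsolutions hwL.continuousOn hΩ hb hu ⟨hphc, by simpa using hp.2⟩
  have hw_le := hwL.le_add_mul hphc hp.1
  rw [hw.eq_zero _ hph] at hu_le hw_le
  rw [dist_self_add_left] at hw_le
  linarith

open Classical in
/-- The competitor obtained from `u` by the translation `h` in the space variable, lowered by
`K ‖h‖` and continued by the barrier `w` where the translate is undefined. -/
noncomputable def translateGlue (Ω : Set (Cn n)) (w : Cn n → ℝ) (K : ℝ≥0) (u : Cn n × ℂ → ℝ)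
    (h : Cn n) : Cn n × ℂ → ℝ :=
  {p : Cn n × ℂ | p.1 + h ∈ Ω}.piecewise
    ((fun p => u (p + (h, 0)) - K * ‖h‖) ⊔ fun p => w p.1) fun p => w p.1

lemma translateGlue_of_mem {p : Cn n × ℂ} (hp : p.1 + h ∈ Ω) :
    translateGlue Ω w K u h p = max (u (p + (h, 0)) - K * ‖h‖) (w p.1) :=
  if_pos hp

lemma translateGlue_of_notMem {p : Cn n × ℂ} (hp : p.1 + h ∉ Ω) :
    translateGlue Ω w K u h p = w p.1 :=
  if_neg hp

open Classical in
lemma IsBarrier.continuousOn_translateGlue (hw : IsBarrier Ω φ₀ φ₁ w)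
    (hwL : LipschitzOnWith K w (closure Ω)) (hΩ : IsOpen Ω) (hb : Bornology.IsBounded Ω)
    (hu : u ∈ subsolutions Ω (boundaryData φ₀ φ₁)) :
    ContinuousOn (translateGlue Ω w K u h) (closure Ω ×ˢ closure annulus) := by
  have htranslate : Continuous fun p : Cn n × ℂ => p.1 + h := by fun_prop
  have hwc := (hw.comp_fst_mem_subsolutions hwL.continuousOn).2.1
  refine ContinuousOn.piecewise (fun p hp => ?_) (.sup ?_ (hwc.mono inter_subset_left))
    (hwc.mono inter_subset_left)
  · exact sup_eq_right.2 (hw.sub_le_of_add_mem_frontier hwL hΩ hb hu hp.1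
      (htranslate.frontier_preimage_subset Ω hp.2))
  · refine (hu.2.1.comp (by fun_prop) fun p hp => ?_).sub continuousOn_const
    exact ⟨htranslate.closure_preimage_subset Ω hp.2, by simpa using hp.1.2⟩

open Classical in
lemma IsBarrier.translateGlue_mem_subsolutions (hw : IsBarrier Ω φ₀ φ₁ w)
    (hwL : LipschitzOnWith K w (closure Ω)) (hφ₀ : LipschitzOnWith K φ₀ (closure Ω))
    (hφ₁ : LipschitzOnWith K φ₁ (closure Ω)) (hΩ : IsOpen Ω) (hb : Bornology.IsBounded Ω)
    (hu : u ∈ subsolutions Ω (boundaryData φ₀ φ₁)) :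
    translateGlue Ω w K u h ∈ subsolutions Ω (boundaryData φ₀ φ₁) := by
  have hwsub := hw.comp_fst_mem_subsolutions hwL.continuousOn
  have hc : ContinuousOn (translateGlue Ω w K u h) (closure Ω ×ˢ closure annulus) :=
    hw.continuousOn_translateGlue hwL hΩ hb hu
  refine ⟨?_, hc, fun p hp => ?_⟩
  · have hG : IsOpen {p : Cn n × ℂ | p.1 + h ∈ Ω} := hΩ.preimage (by fun_prop)
    have htranslate := hu.1.comp_affine (.id ℂ (Cn n × ℂ)) (h, 0)
      (D' := Ω ×ˢ annulus ∩ {p | p.1 + h ∈ Ω}) fun p hp => ⟨hp.2, by simpa using hp.1.2⟩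
    exact isPSH_piecewise_sup (hΩ.prod isOpen_annulus) hG
      (htranslate.add (isPSH_const _ (-(K * ‖h‖)))) hwsub.1
      (hc.mono (prod_mono subset_closure subset_closure))
  · by_cases hph : p.1 + h ∈ Ω
    · rw [translateGlue_of_mem hph]
      exact sup_le (hw.sub_le_boundaryData hwL hφ₀ hφ₁ hΩ hb hu hp (subset_closure hph))
        (hwsub.2.2 p hp)
    · rw [translateGlue_of_notMem hph]
      exact hwsub.2.2 p hp

lemma IsBarrier.sub_le_translateGlue (hw : IsBarrier Ω φ₀ φ₁ w)
    (hwL : LipschitzOnWith K w (closure Ω)) (hΩ : IsOpen Ω) (hb : Bornology.IsBounded Ω)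
    (hu : u ∈ subsolutions Ω (boundaryData φ₀ φ₁)) {p : Cn n × ℂ}
    (hp : p ∈ closure Ω ×ˢ closure annulus) (hph : p.1 + h ∈ closure Ω) :
    u (p + (h, 0)) - K * ‖h‖ ≤ translateGlue Ω w K u h p := by
  by_cases hphΩ : p.1 + h ∈ Ω
  · rw [translateGlue_of_mem hphΩ]
    exact le_max_left _ _
  · rw [translateGlue_of_notMem hphΩ]
    exact hw.sub_le_of_add_mem_frontier hwL hΩ hb hu hp (hΩ.frontier_eq ▸ ⟨hph, hphΩ⟩)

end Translation

section Envelope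

variable {n : ℕ} {Ω : Set (Cn n)} {φ₀ φ₁ w : Cn n → ℝ} {K : ℝ≥0} {ζ : ℂ}

lemma IsBarrier.nonempty_subsolutionValues (hw : IsBarrier Ω φ₀ φ₁ w)
    (hwc : ContinuousOn w (closure Ω)) (p : Cn n × ℂ) :
    (subsolutionValues Ω (boundaryData φ₀ φ₁) p).Nonempty :=
  ⟨_, mem_image_of_mem _ (hw.comp_fst_mem_subsolutions hwc)⟩

lemma IsBarrier.bddAbove_subsolutionValues (hw : IsBarrier Ω φ₀ φ₁ w)
    (hwc : ContinuousOn w (closure Ω)) (hΩ : IsOpen Ω) (hb : Bornology.IsBounded Ω)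
    {p : Cn n × ℂ} (hp : p ∈ closure Ω ×ˢ closure annulus) :
    BddAbove (subsolutionValues Ω (boundaryData φ₀ φ₁) p) :=
  ⟨-w p.1, forall_mem_image.2 fun _ hu => hw.le_neg_of_mem_subsolutions hwc hΩ hb hu hp⟩

lemma IsBarrier.lipschitzOnWith_envelope (hw : IsBarrier Ω φ₀ φ₁ w)
    (hwL : LipschitzOnWith K w (closure Ω)) (hφ₀ : LipschitzOnWith K φ₀ (closure Ω))
    (hφ₁ : LipschitzOnWith K φ₁ (closure Ω)) (hΩ : IsOpen Ω) (hb : Bornology.IsBounded Ω)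
    (hζ : ζ ∈ closure annulus) :
    LipschitzOnWith K (fun z => envelope Ω (boundaryData φ₀ φ₁) (z, ζ)) (closure Ω) := by
  refine .of_le_add_mul K fun x hx y hy => ?_
  refine csSup_le (hw.nonempty_subsolutionValues hwL.continuousOn _)
    (forall_mem_image.2 fun u hu => ?_)
  rw [← sub_le_iff_le_add, dist_eq_norm]
  calc u (x, ζ) - K * ‖x - y‖ ≤ translateGlue Ω w K u (x - y) (y, ζ) := by
        simpa using hw.sub_le_translateGlue hwL hΩ hb hu (h := x - y) (p := (y, ζ)) ⟨hy, hζ⟩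
          (by simpa using hx)
    _ ≤ envelope Ω (boundaryData φ₀ φ₁) (y, ζ) :=
        le_csSup (hw.bddAbove_subsolutionValues hwL.continuousOn hΩ hb ⟨hy, hζ⟩)
          (mem_image_of_mem _ (hw.translateGlue_mem_subsolutions hwL hφ₀ hφ₁ hΩ hb hu))

end Envelope

end MabuchiEnvelope

open MabuchiEnvelope in
theorem theorem2p6_general {n : ℕ} {Ω : Set (Cn n)} (hΩ : IsStrictlyPseudoconvexDomain Ω)
    {φ₀ φ₁ : Cn n → ℝ} {K₀ K₁ : ℝ≥0} (hφ₀ : LipschitzOnWith K₀ φ₀ (closure Ω))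
    (hφ₁ : LipschitzOnWith K₁ φ₁ (closure Ω)) (h₀ : ∀ z ∈ frontier Ω, φ₀ z = 0)
    (h₁ : ∀ z ∈ frontier Ω, φ₁ z = 0) :
    (∀ z ∈ closure Ω, ∀ ζ ∈ closure annulus,
      (subsolutionValues Ω (boundaryData φ₀ φ₁) (z, ζ)).Nonempty ∧
        BddAbove (subsolutionValues Ω (boundaryData φ₀ φ₁) (z, ζ))) ∧
    ∃ C : ℝ≥0, ∀ ζ ∈ closure annulus,
      LipschitzOnWith C (fun z => envelope Ω (boundaryData φ₀ φ₁) (z, ζ)) (closure Ω) := by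
  obtain ⟨L, w, hwL, hw⟩ := hΩ.exists_isBarrier hφ₀ hφ₁ h₀ h₁
  have hwc := hwL.continuousOn
  exact ⟨fun z hz ζ hζ => ⟨hw.nonempty_subsolutionValues hwc _,
      hw.bddAbove_subsolutionValues hwc hΩ.isOpen hΩ.isBounded ⟨hz, hζ⟩⟩,
    max (max K₀ K₁) L, fun ζ hζ => hw.lipschitzOnWith_envelope (hwL.weaken (by simp))
      (hφ₀.weaken (by simp)) (hφ₁.weaken (by simp)) hΩ.isOpen hΩ.isBounded hζ⟩

theorem theorem2p6 (n : ℕ) (Ω : Set (MabuchiEnvelope.Cn n))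
    (hΩ : MabuchiEnvelope.IsStrictlyPseudoconvexDomain Ω)
    (φ₀ φ₁ : MabuchiEnvelope.Cn n → ℝ)
    (h₀ : MabuchiEnvelope.IsEndPoint Ω φ₀) (h₁ : MabuchiEnvelope.IsEndPoint Ω φ₁) :
    (∀ z ∈ closure Ω, ∀ ζ ∈ MabuchiEnvelope.annulus,
      (MabuchiEnvelope.subsolutionValues Ω
          (MabuchiEnvelope.boundaryData φ₀ φ₁) (z, ζ)).Nonempty ∧
        BddAbove (MabuchiEnvelope.subsolutionValues Ω
          (MabuchiEnvelope.boundaryData φ₀ φ₁) (z, ζ))) ∧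
    ∃ C : ℝ≥0, ∀ ζ ∈ MabuchiEnvelope.annulus,
      LipschitzOnWith C
        (fun z => MabuchiEnvelope.envelope Ω (MabuchiEnvelope.boundaryData φ₀ φ₁) (z, ζ))
        (closure Ω) := by
  obtain ⟨K₀, hK₀⟩ := h₀.exists_lipschitzOnWith hΩ.isOpen hΩ.isBounded
  obtain ⟨K₁, hK₁⟩ := h₁.exists_lipschitzOnWith hΩ.isOpen hΩ.isBounded
  obtain ⟨hfinite, C, hC⟩ := theorem2p6_general hΩ hK₀ hK₁ h₀.boundary h₁.boundary
  exact ⟨fun z hz ζ hζ => hfinite z hz ζ (subset_closure hζ),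
    C, fun ζ hζ => hC ζ (subset_closure hζ)⟩
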